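/- There is no superhigh weakly 2-random set. Here a set $A\subseteq\mathbb N$ is superhigh if $\emptyset''\le_{tt}A'$, where $X'=\{e:\Phi^X_e(e)\downarrow\}$ for a standard list $(\Phi^X_e)_{e\in\mathbb N}$ of the functions partial computable in $X$, and $\le_{tt}$ denotes truth-table reducibility. A set $Z\subseteq\mathbb N$, identified with a point of $2^{\mathbb N}$, is weakly 2-random if it belongs to no $\Pi^0_2$ class $\mathcal S\subseteq 2^{\mathbb N}$ with $\lambda(\mathcal S)=0$, where $\lambda$ is the fair-coin measure on $2^{\mathbb N}$. -/

import Mathlib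

namespace Superhigh

/-! ### Oracle computations

Subsets of `ℕ` are identified with their characteristic functions `ℕ → Bool`, that is, with the
points of Cantor space. -/

/-- Programs for oracle computations. The constructors are those of `Nat.RecursiveIn`. -/
inductive OracleCode : Type
  | zero : OracleCode
  | succ : OracleCode
  | left : OracleCode
  | right : OracleCode
  | oracle : OracleCode
  | pair : OracleCode → OracleCode → OracleCode
  | comp : OracleCode → OracleCode → OracleCode
  | prec : OracleCode → OracleCode → OracleCode
  | rfind : OracleCode → OracleCode

namespace OracleCode

/-- The partial function that a program computes with oracle `X`; a query `n` to the oracle is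
answered by `1` if `n` belongs to `X` and by `0` otherwise. -/
def eval (X : ℕ → Bool) : OracleCode → ℕ →. ℕ
  | zero => fun _ => Part.some 0
  | succ => fun n => Part.some (n + 1)
  | left => fun n => Part.some (Nat.unpair n).1
  | right => fun n => Part.some (Nat.unpair n).2
  | oracle => fun n => Part.some (X n).toNat
  | pair f h => fun n => Nat.pair <$> eval X f n <*> eval X h n
  | comp f h => fun n => eval X h n >>= eval X f
  | prec f h => fun p =>
      let (a, n) := Nat.unpair p
      n.rec (eval X f a) fun y IH => do
        let i ← IH
        eval X h (Nat.pair a (Nat.pair y i))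
  | rfind f => fun a => Nat.rfind fun n => (fun m => m = 0) <$> eval X f (Nat.pair a n)

/-- The Gödel number of a program. -/
def toNat : OracleCode → ℕ
  | zero => 0
  | succ => 1
  | left => 2
  | right => 3
  | oracle => 4
  | pair f h => 4 * Nat.pair (toNat f) (toNat h) + 5
  | comp f h => 4 * Nat.pair (toNat f) (toNat h) + 6
  | prec f h => 4 * Nat.pair (toNat f) (toNat h) + 7
  | rfind f => 4 * toNat f + 8

/-- The program with a given Gödel number; this lists all programs. -/
def ofNat : ℕ → OracleCode
  | 0 => zero
  | 1 => succ
  | 2 => left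
  | 3 => right
  | 4 => oracle
  | n + 5 =>
    have h0 : n / 4 < n + 5 := by omega
    have h1 : (Nat.unpair (n / 4)).1 < n + 5 := lt_of_le_of_lt (Nat.unpair_left_le _) h0
    have h2 : (Nat.unpair (n / 4)).2 < n + 5 := lt_of_le_of_lt (Nat.unpair_right_le _) h0
    if n % 4 = 0 then pair (ofNat (Nat.unpair (n / 4)).1) (ofNat (Nat.unpair (n / 4)).2)
    else if n % 4 = 1 then comp (ofNat (Nat.unpair (n / 4)).1) (ofNat (Nat.unpair (n / 4)).2)
    else if n % 4 = 2 then prec (ofNat (Nat.unpair (n / 4)).1) (ofNat (Nat.unpair (n / 4)).2)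
    else rfind (ofNat (n / 4))

/-- Every program occurs in the list. -/
theorem ofNat_toNat (c : OracleCode) : ofNat (toNat c) = c := by
  induction c with
  | zero | succ | left | right | oracle => simp [toNat, ofNat]
  | pair f h ihf ihh => simp [toNat, ofNat, ihf, ihh]
  | comp f h ihf ihh =>
    have h1 : (4 * Nat.pair (toNat f) (toNat h) + 1) / 4 = Nat.pair (toNat f) (toNat h) := by omega
    have h2 : (4 * Nat.pair (toNat f) (toNat h) + 1) % 4 = 1 := by omega
    rw [toNat, ofNat, h1, h2]; simp [ihf, ihh]
  | prec f h ihf ihh =>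
    have h1 : (4 * Nat.pair (toNat f) (toNat h) + 2) / 4 = Nat.pair (toNat f) (toNat h) := by omega
    have h2 : (4 * Nat.pair (toNat f) (toNat h) + 2) % 4 = 2 := by omega
    rw [toNat, ofNat, h1, h2]; simp [ihf, ihh]
  | rfind f ihf =>
    have h1 : (4 * toNat f + 3) / 4 = toNat f := by omega
    have h2 : (4 * toNat f + 3) % 4 = 3 := by omega
    rw [toNat, ofNat, h1, h2]; simp [ihf]

/-- Numbers and programs correspond bijectively. -/
theorem toNat_ofNat (e : ℕ) : toNat (ofNat e) = e := by
  induction e using Nat.strong_induction_on with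
  | _ e ih =>
    match e with
    | 0 | 1 | 2 | 3 | 4 => simp [ofNat, toNat]
    | n + 5 =>
      have h0 : n / 4 < n + 5 := by omega
      have i0 := ih _ h0
      have i1 := ih _ (lt_of_le_of_lt (Nat.unpair_left_le _) h0)
      have i2 := ih _ (lt_of_le_of_lt (Nat.unpair_right_le _) h0)
      rw [ofNat]
      split_ifs <;> simp only [toNat, i0, i1, i2, Nat.pair_unpair] <;> omega

end OracleCode

/-- `Phi X e` is the `e`-th function partial computable in `X`. -/
def Phi (X : ℕ → Bool) (e : ℕ) : ℕ →. ℕ := (OracleCode.ofNat e).eval X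

/-- The list `Phi X` consists of exactly the functions that are partial computable in `X`. -/
theorem recursiveIn_iff_exists_Phi (X : ℕ → Bool) (f : ℕ →. ℕ) :
    Nat.RecursiveIn {fun n => Part.some (X n).toNat} f ↔ ∃ e, Phi X e = f := by
  constructor
  · intro hf
    suffices h : ∃ c : OracleCode, c.eval X = f by
      obtain ⟨c, rfl⟩ := h
      exact ⟨c.toNat, by rw [Phi, OracleCode.ofNat_toNat]⟩
    induction hf with
    | zero => exact ⟨.zero, rfl⟩
    | succ => exact ⟨.succ, rfl⟩
    | left => exact ⟨.left, rfl⟩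
    | right => exact ⟨.right, rfl⟩
    | oracle g hg => exact ⟨.oracle, (Set.mem_singleton_iff.1 hg).symm⟩
    | pair _ _ ihf ihh =>
      obtain ⟨a, rfl⟩ := ihf
      obtain ⟨b, rfl⟩ := ihh
      exact ⟨.pair a b, rfl⟩
    | comp _ _ ihf ihh =>
      obtain ⟨a, rfl⟩ := ihf
      obtain ⟨b, rfl⟩ := ihh
      exact ⟨.comp a b, rfl⟩
    | prec _ _ ihf ihh =>
      obtain ⟨a, rfl⟩ := ihf
      obtain ⟨b, rfl⟩ := ihh
      exact ⟨.prec a b, rfl⟩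
    | rfind _ ihf =>
      obtain ⟨a, rfl⟩ := ihf
      exact ⟨.rfind a, rfl⟩
  · rintro ⟨e, rfl⟩
    rw [Phi]
    induction OracleCode.ofNat e with
    | zero => exact .zero
    | succ => exact .succ
    | left => exact .left
    | right => exact .right
    | oracle => exact .oracle _ rfl
    | pair f h ihf ihh => exact .pair ihf ihh
    | comp f h ihf ihh => exact .comp ihf ihh
    | prec f h ihf ihh => exact .prec ihf ihh
    | rfind f ihf => exact .rfind ihf

open Classical in
/-- The jump `X' = {e | Φ_e^X(e) is defined}`. -/
noncomputable def jump (X : ℕ → Bool) : ℕ → Bool := fun e => decide (Phi X e e).Dom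

/-- Truth-table reducibility of `A` to `B`: from `n` one computes a finite list of queries and a
truth table, given as the list of the accepted vectors of answers, such that `n` belongs to `A`
if and only if the vector of the answers that `B` gives to the queries is accepted. -/
def TruthTableReducible (A B : ℕ → Bool) : Prop :=
  ∃ (query : ℕ → List ℕ) (table : ℕ → List (List Bool)),
    Computable query ∧ Computable table ∧ ∀ n, A n = true ↔ (query n).map B ∈ table n

/-- `A` is superhigh: the second jump of the empty set is truth-table reducible to `A'`. -/
def IsSuperhigh (A : ℕ → Bool) : Prop :=
  TruthTableReducible (jump (jump fun _ => false)) (jump A)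

/-! ### Weak 2-randomness -/

/-- The string of the first `n` bits of `Z`. -/
def initSeg (Z : ℕ → Bool) (n : ℕ) : List Bool := (List.range n).map Z

/-- A `Π⁰₂` class: the intersection of a uniformly computably enumerable sequence of open sets,
where the `m`-th open set consists of the extensions of the strings `σ` with `W m σ`. -/
def IsPi02Class (S : Set (ℕ → Bool)) : Prop :=
  ∃ W : ℕ → List Bool → Prop, REPred (fun p : ℕ × List Bool => W p.1 p.2) ∧
    S = {Z | ∀ m, ∃ n, W m (initSeg Z n)}

/-- The uniform (fair-coin) measure on Cantor space. -/
noncomputable def coinMeasure : MeasureTheory.Measure (ℕ → Bool) :=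
  MeasureTheory.Measure.infinitePi fun _ => (PMF.uniformOfFintype Bool).toMeasure

/-- `Z` is weakly 2-random: it belongs to no `Π⁰₂` class of measure zero. -/
def IsWeaklyTwoRandom (Z : ℕ → Bool) : Prop :=
  ∀ S : Set (ℕ → Bool), IsPi02Class S → coinMeasure S = 0 → Z ∉ S

end Superhigh

namespace Superhigh

/-! ### Finite oracles -/

/-! Suppose a truth-table reduction takes `Z'` to `∅''`. For a computable `h`, let `V A n` be the
verdict of this reduction at `h n` when its queries are answered by `A'`. The jump is a limit of
computable approximations (`eventually_haltsWithin`), so `V A n` is a limit of values computed from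
initial segments of `A`, uniformly in `A` and `n`.

A sequence `D` is built bit by bit so that the oracles `A` for which `V A` agrees with `D` on the
first `n` bits have measure at most `(3/4)^n`. One of the two possible next bits retains at most
half of the measure, and the gap between `1/2` and `3/4` allows a good bit to be found in the limit,
from computable approximations to the measures (`exists_eventually_flag_eq`, `exists_diagonal`).

Thus `D` is a limit of computable approximations, hence many-one reducible to `∅''`. The
construction of `D` depends on `h`, but by the recursion theorem `h` can itself be taken to be such
a reduction (`exists_diagonal_code`). Then `V Z n = ∅''(h n) = D n` for all `n`. The class of all
`A` with `V A = D` is null, and it is `Π⁰₂`: both sides are limits, so equality at `n` means that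
the approximations agree infinitely often. Hence `Z` is not weakly 2-random. -/

theorem initSeg_succ (Z : ℕ → Bool) (n : ℕ) : initSeg Z (n + 1) = initSeg Z n ++ [Z n] := by
  simp [initSeg, List.range_succ]

@[simp] theorem length_initSeg (Z : ℕ → Bool) (n : ℕ) : (initSeg Z n).length = n := by
  simp [initSeg]

theorem getElem?_initSeg (Z : ℕ → Bool) (n i : ℕ) :
    (initSeg Z n)[i]? = if i < n then some (Z i) else none := by
  split_ifs with h <;> simp [initSeg, h]

theorem initSeg_congr {Y Z : ℕ → Bool} {n : ℕ} : initSeg Y n = initSeg Z n ↔ ∀ i < n, Y i = Z i := by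
  simp [initSeg]

/-- A short initial segment can be read off a longer one. -/
theorem initSeg_getD_initSeg (Z : ℕ → Bool) {k n : ℕ} (h : k ≤ n) :
    initSeg (fun i => (initSeg Z n).getD i false) k = initSeg Z k := by
  rw [initSeg_congr]
  intro i hi
  rw [List.getD_eq_getElem?_getD, getElem?_initSeg, if_pos (hi.trans_le h), Option.getD_some]

open Nat.Partrec (Code)

/-! ### Evaluation rules for oracle-free programs -/

section CodeEval

variable (f g : Code) (n a m : ℕ)

theorem code_eval_zero : Code.zero.eval n = Part.some 0 := rfl

theorem code_eval_succ : Code.succ.eval n = Part.some (n + 1) := rfl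

theorem code_eval_left : Code.left.eval n = Part.some (Nat.unpair n).1 := rfl

theorem code_eval_right : Code.right.eval n = Part.some (Nat.unpair n).2 := rfl

theorem code_eval_pair : (Code.pair f g).eval n =
    ((f.eval n).map Nat.pair).bind fun b => (g.eval n).map b := rfl

theorem code_eval_comp : (Code.comp f g).eval n = (g.eval n).bind fun b => f.eval b := rfl

theorem code_eval_prec : (Code.prec f g).eval (Nat.pair a n) =
    Nat.rec (f.eval a)
      (fun y IH => IH.bind fun i => g.eval (Nat.pair a (Nat.pair y i))) n := by
  simp only [Code.eval, Nat.unpaired, Nat.unpair_pair]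
  rfl

theorem code_eval_rfind' : (Code.rfind' f).eval (Nat.pair a m) =
    (Nat.rfind fun n => (f.eval (Nat.pair a (n + m))).map fun m => decide (m = 0)).map (· + m) := by
  simp only [Code.eval, Nat.unpaired, Nat.unpair_pair]
  rfl

end CodeEval

theorem exists_lookupCode : ∃ c : Code, ∀ (σ : List Bool) (n : ℕ),
    c.eval (Nat.pair (Encodable.encode σ) n) = Part.ofOption (σ[n]?.map Bool.toNat) := by
  have h : Partrec fun p : List Bool × ℕ => (Part.ofOption (p.1[p.2]?.map Bool.toNat) : Part ℕ) := by
    apply Computable.ofOption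
    apply Primrec.to_comp
    exact Primrec.option_map (Primrec.list_getElem?.comp Primrec.fst Primrec.snd)
      ((Primrec.dom_finite Bool.toNat).comp Primrec.snd).to₂
  obtain ⟨c, hc⟩ := Code.exists_code.1 h
  refine ⟨c, fun σ n => ?_⟩
  have : Nat.pair (Encodable.encode σ) n = Encodable.encode (σ, n) := rfl
  rw [hc, this]
  simp only [Encodable.encodek, Part.coe_some, Part.bind_some]
  exact Part.map_id' (fun _ => rfl) _

/-- A program that looks up a bit of a string. -/
noncomputable def lookupCode : Code := exists_lookupCode.choose

theorem eval_lookupCode (σ : List Bool) (n : ℕ) :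
    lookupCode.eval (Nat.pair (Encodable.encode σ) n) = Part.ofOption (σ[n]?.map Bool.toNat) :=
  exists_lookupCode.choose_spec σ n

/-- The code for `((s, a), b) ↦ (s, (a, b))`. -/
def assocCode : Code :=
  .pair (.comp .left .left) (.pair (.comp .right .left) .right)

/-- The code for `(s, (a, b)) ↦ ((s, a), b)`. -/
def assocSymmCode : Code :=
  .pair (.pair .left (.comp .left .right)) (.comp .right .right)

@[simp] theorem eval_assocCode (s a b : ℕ) :
    assocCode.eval (Nat.pair (Nat.pair s a) b) = Part.some (Nat.pair s (Nat.pair a b)) := by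
  simp [assocCode, code_eval_left, code_eval_right, code_eval_pair, code_eval_comp]

@[simp] theorem eval_assocSymmCode (s a b : ℕ) :
    assocSymmCode.eval (Nat.pair s (Nat.pair a b)) = Part.some (Nat.pair (Nat.pair s a) b) := by
  simp [assocSymmCode, code_eval_left, code_eval_right, code_eval_pair, code_eval_comp]

/-! ### Running oracle programs on finite strings -/

namespace OracleCode

/-- The oracle-free program which on input `(σ, n)` runs an oracle program on input `n`, the
string `σ` serving as the oracle. It diverges if a query exceeds the length of `σ`. -/
noncomputable def toCode : OracleCode → Code
  | zero => .zero
  | succ => .comp .succ .right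
  | left => .comp .left .right
  | right => .comp .right .right
  | oracle => lookupCode
  | pair f h => .pair (toCode f) (toCode h)
  | comp f h => .comp (toCode f) (.pair .left (toCode h))
  | prec f h => .comp (.prec (toCode f) (.comp (toCode h) assocCode)) assocSymmCode
  -- `rfind'` takes the starting point of its search as a second argument, here `0`; `assocCode`
  -- regroups `((σ, a), n)` as `(σ, (a, n))`.
  | rfind f => .comp (.rfind' (.comp (toCode f) assocCode)) (.pair (.pair .left .right) .zero)

theorem eval_toCode_prec (f h : OracleCode) (s a n : ℕ) :
    (toCode (prec f h)).eval (Nat.pair s (Nat.pair a n)) =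
      Nat.rec ((toCode f).eval (Nat.pair s a))
        (fun y IH => IH.bind fun i => (toCode h).eval (Nat.pair s (Nat.pair a (Nat.pair y i)))) n := by
  simp [toCode, code_eval_comp, code_eval_prec]

theorem eval_toCode_rfind (f : OracleCode) (s a : ℕ) :
    (toCode (rfind f)).eval (Nat.pair s a) =
      Nat.rfind fun n => ((toCode f).eval (Nat.pair s (Nat.pair a n))).map
        fun m => decide (m = 0) := by
  simp [toCode, code_eval_zero, code_eval_left, code_eval_right, code_eval_pair, code_eval_comp,
    code_eval_rfind', Part.map_id']

theorem eval_pair (X : ℕ → Bool) (f h : OracleCode) (n : ℕ) : (pair f h).eval X n =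
    ((f.eval X n).map Nat.pair).bind fun b => (h.eval X n).map b := rfl

theorem eval_comp (X : ℕ → Bool) (f h : OracleCode) (n : ℕ) :
    (comp f h).eval X n = (h.eval X n).bind fun b => f.eval X b := rfl

theorem eval_rfind (X : ℕ → Bool) (f : OracleCode) (a : ℕ) : (rfind f).eval X a =
    Nat.rfind fun n => (f.eval X (Nat.pair a n)).map fun m => decide (m = 0) := rfl

theorem mem_rfind_map {f : ℕ → Part ℕ} {x : ℕ} :
    (x ∈ Nat.rfind fun n => (f n).map fun m => decide (m = 0)) ↔
      0 ∈ f x ∧ ∀ m < x, ∃ a ∈ f m, a ≠ 0 := by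
  refine Nat.mem_rfind.trans (and_congr ?_ ?_)
  · simp
  · simp

theorem eval_prec_pair (X : ℕ → Bool) (f h : OracleCode) (a n : ℕ) :
    (prec f h).eval X (Nat.pair a n) =
      Nat.rec (f.eval X a)
        (fun y IH => IH.bind fun i => h.eval X (Nat.pair a (Nat.pair y i))) n := by
  simp only [eval, Nat.unpair_pair]
  rfl

/-- A string never gives a wrong answer: queries beyond its length diverge instead of receiving a
default value. -/
theorem mem_eval_of_mem_eval_toCode {X : ℕ → Bool} {k : ℕ} {c : OracleCode} {n x : ℕ}
    (hx : x ∈ (toCode c).eval (Nat.pair (Encodable.encode (initSeg X k)) n)) : x ∈ c.eval X n := by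
  induction c generalizing n x with
  | zero => simpa [toCode, eval, code_eval_zero] using hx
  | succ => simpa [toCode, eval, code_eval_comp, code_eval_right, code_eval_succ] using hx
  | left => simpa [toCode, eval, code_eval_comp, code_eval_right, code_eval_left] using hx
  | right => simpa [toCode, eval, code_eval_comp, code_eval_right, code_eval_right] using hx
  | oracle =>
    rw [toCode, eval_lookupCode, getElem?_initSeg] at hx
    split_ifs at hx <;> simp_all [eval]
  | pair f h ihf ihh =>
    simp only [toCode, code_eval_pair, eval_pair, Part.mem_bind_iff, Part.mem_map_iff] at hx ⊢
    obtain ⟨_, ⟨a, ha, rfl⟩, b, hb, rfl⟩ := hx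
    exact ⟨_, ⟨a, ihf ha, rfl⟩, b, ihh hb, rfl⟩
  | comp f h ihf ihh =>
    simp only [toCode, code_eval_comp, code_eval_pair, code_eval_left, eval_comp, Part.mem_bind_iff,
      Part.mem_map_iff, Part.map_some, Part.bind_some, Nat.unpair_pair] at hx ⊢
    obtain ⟨_, ⟨b, hb, rfl⟩, hx⟩ := hx
    exact ⟨b, ihh hb, ihf hx⟩
  | prec f h ihf ihh =>
    obtain ⟨a, n, rfl⟩ : ∃ a m, n = Nat.pair a m := ⟨_, _, (Nat.pair_unpair n).symm⟩
    rw [eval_toCode_prec] at hx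
    rw [eval_prec_pair]
    induction n generalizing x with
    | zero => exact ihf hx
    | succ n ih =>
      simp only [Part.mem_bind_iff] at hx ⊢
      obtain ⟨i, hi, hx⟩ := hx
      exact ⟨i, ih hi, ihh hx⟩
  | rfind f ihf =>
    rw [eval_toCode_rfind, mem_rfind_map] at hx
    rw [eval_rfind, mem_rfind_map]
    refine ⟨ihf hx.1, fun m hm => ?_⟩
    obtain ⟨a, ha, h⟩ := hx.2 m hm
    exact ⟨a, ihf ha, h⟩

-- The use principle: a convergent computation consults only finitely many bits. For `rfind`, the
-- finitely many computations below the result are handled simultaneously.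
open Filter in
theorem eventually_mem_eval_toCode {X : ℕ → Bool} {c : OracleCode} {n x : ℕ}
    (hx : x ∈ c.eval X n) :
    ∀ᶠ k in atTop, x ∈ (toCode c).eval (Nat.pair (Encodable.encode (initSeg X k)) n) := by
  induction c generalizing n x with
  | zero => exact .of_forall fun k => by simpa [toCode, eval, code_eval_zero] using hx
  | succ =>
    exact .of_forall fun k => by
      simpa [toCode, eval, code_eval_comp, code_eval_right, code_eval_succ] using hx
  | left =>
    exact .of_forall fun k => by
      simpa [toCode, eval, code_eval_comp, code_eval_right, code_eval_left] using hx
  | right =>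
    exact .of_forall fun k => by
      simpa [toCode, eval, code_eval_comp, code_eval_right, code_eval_right] using hx
  | oracle =>
    filter_upwards [eventually_gt_atTop n] with k hk
    rw [toCode, eval_lookupCode, getElem?_initSeg, if_pos hk]
    simpa [eval] using hx
  | pair f h ihf ihh =>
    simp only [eval_pair, Part.mem_bind_iff, Part.mem_map_iff] at hx
    obtain ⟨_, ⟨a, ha, rfl⟩, b, hb, rfl⟩ := hx
    filter_upwards [ihf ha, ihh hb] with k hka hkb
    simp only [toCode, code_eval_pair, Part.mem_bind_iff, Part.mem_map_iff]
    exact ⟨_, ⟨a, hka, rfl⟩, b, hkb, rfl⟩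
  | comp f h ihf ihh =>
    simp only [eval_comp, Part.mem_bind_iff] at hx
    obtain ⟨b, hb, hx⟩ := hx
    filter_upwards [ihf hx, ihh hb] with k hka hkb
    simp only [toCode, code_eval_comp, code_eval_pair, code_eval_left, Part.mem_bind_iff,
      Part.mem_map_iff, Part.map_some, Part.bind_some, Nat.unpair_pair]
    exact ⟨_, ⟨b, hkb, rfl⟩, hka⟩
  | prec f h ihf ihh =>
    obtain ⟨a, n, rfl⟩ : ∃ a m, n = Nat.pair a m := ⟨_, _, (Nat.pair_unpair n).symm⟩
    simp only [eval_toCode_prec]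
    rw [eval_prec_pair] at hx
    induction n generalizing x with
    | zero => exact ihf hx
    | succ n ih =>
      simp only [Part.mem_bind_iff] at hx ⊢
      obtain ⟨i, hi, hx⟩ := hx
      filter_upwards [ih hi, ihh hx] with k h1 h2
      exact ⟨i, h1, h2⟩
  | rfind f ihf =>
    simp only [eval_toCode_rfind, mem_rfind_map]
    rw [eval_rfind, mem_rfind_map] at hx
    have : ∀ m ∈ Set.Iio x, ∀ᶠ k in atTop, ∃ a ∈ (toCode f).eval
        (Nat.pair (Encodable.encode (initSeg X k)) (Nat.pair n m)), a ≠ 0 := by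
      intro m hm
      obtain ⟨a, ha, h⟩ := hx.2 m hm
      filter_upwards [ihf ha] with k hk using ⟨a, hk, h⟩
    exact (ihf hx.1).and ((Set.finite_Iio x).eventually_all.2 this)

/-- Makes the approximations to the jump computable uniformly in the index. The proof is a
course-of-values recursion on Gödel numbers. -/
theorem primrec_toCode_ofNat : Primrec fun e => toCode (ofNat e) := by
  have hpair : Primrec₂ fun a b : Code => Code.pair a b := Code.primrec₂_pair
  have hcomp : Primrec₂ fun a b : Code => Code.comp a b := Code.primrec₂_comp
  have hprec : Primrec₂ fun a b : Code => Code.prec a b := Code.primrec₂_prec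
  -- `l` lists the translations of all programs with smaller numbers, so `l.length` is the number
  -- being decoded; the first five are the base programs.
  let step : Unit → List Code → Option Code := fun _ l =>
    let m := l.length - 5
    if l.length < 5 then
      [Code.zero, .comp .succ .right, .comp .left .right, .comp .right .right, lookupCode][l.length]?
    else if m % 4 = 3 then
      l[m / 4]?.map fun a => .comp (.rfind' (.comp a assocCode)) (.pair (.pair .left .right) .zero)
    else l[(Nat.unpair (m / 4)).1]?.bind fun a => l[(Nat.unpair (m / 4)).2]?.map fun b =>
      if m % 4 = 0 then .pair a b
      else if m % 4 = 1 then .comp a (.pair .left b)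
      else .comp (.prec a (.comp b assocCode)) assocSymmCode
  have hstep : Primrec₂ step := by
    have hlen : Primrec fun p : Unit × List Code => p.2.length :=
      Primrec.list_length.comp Primrec.snd
    have hm : Primrec fun p : Unit × List Code => p.2.length - 5 :=
      Primrec.nat_sub.comp hlen (Primrec.const 5)
    have hdiv : Primrec fun p : Unit × List Code => (p.2.length - 5) / 4 :=
      Primrec.nat_div.comp hm (Primrec.const 4)
    have hmod : Primrec fun p : Unit × List Code => (p.2.length - 5) % 4 :=
      Primrec.nat_mod.comp hm (Primrec.const 4)
    refine Primrec.ite (Primrec.nat_lt.comp hlen (Primrec.const 5)) ?_ (Primrec.ite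
      (Primrec.eq.comp hmod (Primrec.const 3)) ?_ ?_)
    · exact Primrec.list_getElem?.comp (Primrec.const _) hlen
    · refine Primrec.option_map (Primrec.list_getElem?.comp Primrec.snd hdiv) ?_
      exact (hcomp.comp (Code.primrec_rfind'.comp (hcomp.comp Primrec.snd (Primrec.const _)))
        (Primrec.const _)).to₂
    · refine Primrec.option_bind (Primrec.list_getElem?.comp Primrec.snd
        (Primrec.fst.comp (Primrec.unpair.comp hdiv))) ?_
      refine Primrec.option_map (Primrec.list_getElem?.comp (Primrec.snd.comp Primrec.fst)
        (Primrec.snd.comp (Primrec.unpair.comp (hdiv.comp Primrec.fst)))) ?_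
      have hmod' : Primrec fun p : ((Unit × List Code) × Code) × Code =>
        (p.1.1.2.length - 5) % 4 := hmod.comp (Primrec.fst.comp Primrec.fst)
      have ha : Primrec fun p : ((Unit × List Code) × Code) × Code => p.1.2 :=
        Primrec.snd.comp Primrec.fst
      have hb : Primrec fun p : ((Unit × List Code) × Code) × Code => p.2 := Primrec.snd
      exact (Primrec.ite (Primrec.eq.comp hmod' (Primrec.const 0)) (hpair.comp ha hb) (Primrec.ite
        (Primrec.eq.comp hmod' (Primrec.const 1)) (hcomp.comp ha (hpair.comp (Primrec.const _) hb))
        (hcomp.comp (hprec.comp ha (hcomp.comp hb (Primrec.const _))) (Primrec.const _)))).to₂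
  refine (Primrec.nat_strong_rec (fun (_ : Unit) e => toCode (ofNat e)) hstep ?_).comp
    (Primrec.const ()) Primrec.id
  intro _ n
  simp only [step, List.length_map, List.length_range]
  match n with
  | 0 | 1 | 2 | 3 | 4 => simp [ofNat, toCode]
  | n + 5 =>
    have h0 : n / 4 < n + 5 := by omega
    have h1 : (Nat.unpair (n / 4)).1 < n + 5 := lt_of_le_of_lt (Nat.unpair_left_le _) h0
    have h2 : (Nat.unpair (n / 4)).2 < n + 5 := lt_of_le_of_lt (Nat.unpair_right_le _) h0
    have h3 : n % 4 = 0 ∨ n % 4 = 1 ∨ n % 4 = 2 ∨ n % 4 = 3 := by omega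
    rw [ofNat]
    rcases h3 with h | h | h | h <;> simp [h, h0, h1, h2, toCode]

end OracleCode

/-- Whether the `e`-th program halts on input `e` within `|σ|` steps, some initial segment of `σ`
serving as the oracle. -/
noncomputable def haltsWithin (σ : List Bool) (e : ℕ) : Bool :=
  decide (∃ k < σ.length + 1, (Code.evaln σ.length (OracleCode.ofNat e).toCode
    (Nat.pair (Encodable.encode (initSeg (fun i => σ.getD i false) k)) e)).isSome = true)

theorem primrec_initSeg {α : Type*} [Primcodable α] {f : α → ℕ → Bool} {g : α → ℕ}
    (hf : Primrec₂ f) (hg : Primrec g) : Primrec fun a => initSeg (f a) (g a) :=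
  Primrec.list_map (Primrec.list_range.comp hg) hf

theorem primrec_haltsWithin : Primrec₂ haltsWithin := by
  have h : PrimrecRel fun (k : ℕ) (p : List Bool × ℕ) =>
      (Code.evaln p.1.length (OracleCode.ofNat p.2).toCode
        (Nat.pair (Encodable.encode (initSeg (fun i => p.1.getD i false) k)) p.2)).isSome = true := by
    have h1 : Primrec fun q : ℕ × List Bool × ℕ => q.2.1.length :=
      Primrec.list_length.comp (Primrec.fst.comp Primrec.snd)
    have he : Primrec fun q : ℕ × List Bool × ℕ => q.2.2 := Primrec.snd.comp Primrec.snd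
    have h2 : Primrec fun q : ℕ × List Bool × ℕ => initSeg (fun i => q.2.1.getD i false) q.1 :=
      primrec_initSeg ((Primrec.list_getD false).comp
        (Primrec.fst.comp (Primrec.snd.comp Primrec.fst)) Primrec.snd).to₂ Primrec.fst
    exact Primrec.eq.comp (Primrec.option_isSome.comp (Code.primrec_evaln.comp
      ((h1.pair (OracleCode.primrec_toCode_ofNat.comp he)).pair
        (Primrec₂.natPair.comp (Primrec.encode.comp h2) he)))) (Primrec.const true)
  have h' : PrimrecPred fun p : List Bool × ℕ => ∃ k ∈ List.range (p.1.length + 1), _ :=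
    h.exists_mem_list.comp
      (Primrec.list_range.comp (Primrec.succ.comp (Primrec.list_length.comp Primrec.fst))) Primrec.id
  exact h'.decide.of_eq fun p => by simp [haltsWithin]

open Filter in
/-- The jump is the limit of its computable approximations. -/
theorem eventually_haltsWithin (X : ℕ → Bool) (e : ℕ) :
    ∀ᶠ t in atTop, haltsWithin (initSeg X t) e = jump X e := by
  have key (t : ℕ) : haltsWithin (initSeg X t) e = true ↔ ∃ k ≤ t, ∃ x,
      x ∈ Code.evaln t (OracleCode.ofNat e).toCode (Nat.pair (Encodable.encode (initSeg X k)) e) := by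
    simp only [haltsWithin, decide_eq_true_eq, length_initSeg, Option.isSome_iff_exists,
      Nat.lt_succ_iff, Option.mem_def]
    refine exists_congr fun k => and_congr_right fun hk => ?_
    rw [initSeg_getD_initSeg X hk]
  by_cases h : (Phi X e e).Dom
  · obtain ⟨x, hx⟩ := Part.dom_iff_mem.1 h
    obtain ⟨k, hk⟩ := (OracleCode.eventually_mem_eval_toCode hx).exists
    obtain ⟨s, hs⟩ := Code.evaln_complete.1 hk
    -- The oracle prefix keeps its length `k` while the step bound grows, so monotonicity in the
    -- oracle string is not needed.
    filter_upwards [eventually_ge_atTop k, eventually_ge_atTop s] with t hkt hst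
    rw [show jump X e = true by simpa [jump] using h, key]
    exact ⟨k, hkt, x, Code.evaln_mono hst hs⟩
  · refine .of_forall fun t => ?_
    rw [show jump X e = false by simpa [jump] using h, ← Bool.not_eq_true, key]
    rintro ⟨k, -, x, hx⟩
    exact h (Part.dom_iff_mem.2 ⟨x, OracleCode.mem_eval_of_mem_eval_toCode (Code.evaln_sound hx)⟩)

end Superhigh

namespace Superhigh

/-! ### Many-one reductions to jumps -/

namespace OracleCode

/-- A program for a constant function. -/
def const : ℕ → OracleCode
  | 0 => zero
  | n + 1 => comp succ (const n)

theorem eval_const (X : ℕ → Bool) (n m : ℕ) : (const n).eval X m = Part.some n := by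
  induction n with
  | zero => rfl
  | succ n ih =>
    rw [const, eval_comp, ih, Part.bind_some]
    rfl

theorem primrec_toNat_const : Primrec fun n => (const n).toNat := by
  have h : Primrec₂ fun (_ : ℕ) (p : ℕ × ℕ) => 4 * Nat.pair 1 p.2 + 6 :=
    (Primrec.nat_add.comp (Primrec.nat_mul.comp (Primrec.const 4) (Primrec₂.natPair.comp
      (Primrec.const 1) (Primrec.snd.comp Primrec.snd))) (Primrec.const 6)).to₂
  refine (Primrec.nat_rec' Primrec.id (Primrec.const 0) h).of_eq fun n => ?_
  induction n with
  | zero => rfl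
  | succ n ih => simp only [id] at ih ⊢; rw [ih]; rfl

end OracleCode

theorem jump_eq_true {X : ℕ → Bool} {e : ℕ} : jump X e = true ↔ (Phi X e e).Dom := by
  simp [jump]

/-- Every domain of a function partial computable in `X` is many-one reducible to `X'`. -/
theorem exists_computable_jump_iff_dom {X : ℕ → Bool} {f : ℕ →. ℕ}
    (hf : Nat.RecursiveIn {fun n => Part.some (X n).toNat} f) :
    ∃ h : ℕ → ℕ, Computable h ∧ ∀ n, jump X (h n) = true ↔ (f n).Dom := by
  obtain ⟨a, rfl⟩ := (recursiveIn_iff_exists_Phi X f).1 hf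
  -- The program ignores its input and runs `a` on `n`, so applying it to its own index tests
  -- whether `f n` is defined.
  refine ⟨fun n => (OracleCode.comp (OracleCode.ofNat a) (OracleCode.const n)).toNat, ?_, fun n => ?_⟩
  · exact (Primrec.nat_add.comp (Primrec.nat_mul.comp (Primrec.const 4) (Primrec₂.natPair.comp
      (Primrec.const _) OracleCode.primrec_toNat_const)) (Primrec.const 6)).to_comp
  · rw [jump_eq_true, Phi, OracleCode.ofNat_toNat, OracleCode.eval_comp, OracleCode.eval_const,
      Part.bind_some, Phi]

theorem rfind_some_dom (p : ℕ → Bool) :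
    (Nat.rfind fun t => (Part.some (p t) : Part Bool)).Dom ↔ ∃ t, p t = true := by
  refine (Nat.rfind_dom (p := fun t => (Part.some (p t) : Part Bool))).trans ?_
  constructor
  · rintro ⟨t, ht, -⟩
    exact ⟨t, (Part.mem_some_iff.1 ht).symm⟩
  · rintro ⟨t, ht⟩
    exact ⟨t, Part.mem_some_iff.2 ht.symm, fun _ => trivial⟩

/-- Every `Σ⁰₂` set is many-one reducible to `∅''`. -/
theorem exists_computable_jump_jump_iff {R : ℕ → ℕ → ℕ → Bool}
    (hR : Computable fun p : (ℕ × ℕ) × ℕ => R p.1.1 p.1.2 p.2) :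
    ∃ h : ℕ → ℕ, Computable h ∧
      ∀ n, jump (jump fun _ => false) (h n) = true ↔ ∃ s, ∀ t, R n s t = true := by
  -- The search for a counterexample `t` halts exactly when `∀ t` fails, a question for `∅'`.
  have hf : Partrec fun m : ℕ => Nat.rfind fun t =>
      (Part.some (!R m.unpair.1 m.unpair.2 t) : Part Bool) := by
    refine Partrec.rfind (p := fun (m t : ℕ) =>
      (Part.some (!R m.unpair.1 m.unpair.2 t) : Part Bool)) ?_
    exact (Primrec.not.to_comp.comp (hR.comp
      ((Computable.unpair.comp Computable.fst).pair Computable.snd))).partrec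
  obtain ⟨g, hg, hg'⟩ := exists_computable_jump_iff_dom (X := fun _ => false)
    (Nat.Partrec.recursiveIn (Partrec.nat_iff.1 hf))
  set J := jump fun _ => false
  have hg0 : Nat.RecursiveIn {fun n => Part.some (J n).toNat} (fun n => Part.some (g n)) :=
    Nat.Partrec.recursiveIn (Partrec.nat_iff.1 hg)
  -- With oracle `∅'`, search for an `s` whose counterexample search diverges, that is, where the
  -- oracle answers `0`.
  obtain ⟨h, hh, hh'⟩ := exists_computable_jump_iff_dom (X := J)
    (Nat.RecursiveIn.rfind (Nat.RecursiveIn.comp (.oracle _ rfl) hg0))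
  have hg'' (n s : ℕ) : J (g (Nat.pair n s)) = false ↔ ∀ t, R n s t = true := by
    rw [← Bool.not_eq_true, hg', rfind_some_dom]
    simp
  have hrow (n : ℕ) : (fun s => ((Part.some (g (Nat.pair n s))).bind fun m =>
      Part.some (J m).toNat).map fun m => decide (m = 0)) =
      fun s => Part.some (!J (g (Nat.pair n s))) := by
    funext s
    rw [Part.bind_some, Part.map_some]
    cases J (g (Nat.pair n s)) <;> rfl
  refine ⟨h, hh, fun n => (hh' n).trans ?_⟩
  refine (iff_of_eq (congrArg (fun p : ℕ → Part Bool => (Nat.rfind p).Dom) (hrow n))).trans ?_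
  rw [rfind_some_dom]
  simp only [Bool.not_eq_true', hg'']

/-! ### Computable approximations -/

open Nat.Partrec (Code)

/-- The queries and the truth table which the program `c` computes from `n` within `t` steps. -/
def row (c : Code) (n t : ℕ) : List ℕ × List (List Bool) :=
  ((Code.evaln t c n).bind Encodable.decode).getD ([], [])

/-- The approximation, based on the string `σ`, to the value at `n` of the truth-table reduction
computed by `c`, applied to the jump. -/
noncomputable def acceptsAt (c : Code) (σ : List Bool) (n : ℕ) : Bool :=
  decide ((row c n σ.length).1.map (haltsWithin σ) ∈ (row c n σ.length).2)

/-- Whether the values approximated on the basis of `σ` begin with `τ`. -/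
noncomputable def matchesAt (c : Code) (τ σ : List Bool) : Bool :=
  decide (initSeg (acceptsAt c σ) τ.length = τ)

/-- The binary strings of a given length. -/
def strings : ℕ → List (List Bool)
  | 0 => [[]]
  | t + 1 => (strings t).flatMap fun σ => [σ ++ [false], σ ++ [true]]

/-- The number of strings of length `t` on which the approximated values begin with `τ`. -/
noncomputable def count (c : Code) (τ : List Bool) (t : ℕ) : ℕ :=
  ((strings t).filter fun σ => matchesAt c τ σ = true).length

/-- The `t`-th approximation to a bit `b` for which the values of at most a `(3/4) ^ (|τ| + 1)`
fraction of the oracles begin with `τ ++ [b]`. -/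
noncomputable def flag (c : Code) (τ : List Bool) : ℕ → Bool
  | 0 => false
  -- The fraction of strings is compared with `(3/4)^(|τ|+1)`, denominators cleared; the bit flips
  -- only when its current value looks too heavy.
  | t + 1 => if 3 ^ (τ.length + 1) * 2 ^ t < count c (τ ++ [flag c τ t]) t * 4 ^ (τ.length + 1)
      then !flag c τ t else flag c τ t

/-- The `t`-th approximation to the string of the first `n` bits of the diagonal sequence. -/
noncomputable def diagString (c : Code) : ℕ → ℕ → List Bool
  | 0, _ => []
  | n + 1, t => diagString c n t ++ [flag c (diagString c n t) t]

/-! ### Primitive recursiveness of the approximations -/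

theorem primrec_row : Primrec fun p : (Code × ℕ) × ℕ => row p.1.1 p.1.2 p.2 := by
  refine Primrec.option_getD.comp (Primrec.option_bind (Code.primrec_evaln.comp
    ((Primrec.snd.pair (Primrec.fst.comp Primrec.fst)).pair (Primrec.snd.comp Primrec.fst)))
    ((Primrec.decode.comp Primrec.snd).to₂)) (Primrec.const ([], []))

theorem primrec_acceptsAt : Primrec fun p : (Code × List Bool) × ℕ => acceptsAt p.1.1 p.1.2 p.2 := by
  have hrow : Primrec fun p : (Code × List Bool) × ℕ => row p.1.1 p.2 p.1.2.length :=
    primrec_row.comp (((Primrec.fst.comp Primrec.fst).pair Primrec.snd).pair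
      (Primrec.list_length.comp (Primrec.snd.comp Primrec.fst)))
  have hmem : PrimrecRel fun (L : List (List Bool)) v => ∃ w ∈ L, w = v :=
    (Primrec.eq : PrimrecRel fun w v : List Bool => w = v).exists_mem_list
  have hhalt : Primrec₂ fun (p : (Code × List Bool) × ℕ) (e : ℕ) => haltsWithin p.1.2 e :=
    (primrec_haltsWithin.comp (Primrec.snd.comp (Primrec.fst.comp Primrec.fst)) Primrec.snd).to₂
  exact (hmem.comp (Primrec.snd.comp hrow) (Primrec.list_map (Primrec.fst.comp hrow)
    hhalt)).decide.of_eq fun p => by simp [acceptsAt]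

theorem primrec_matchesAt :
    Primrec fun p : (Code × List Bool) × List Bool => matchesAt p.1.1 p.1.2 p.2 := by
  have hτ : Primrec fun p : (Code × List Bool) × List Bool => p.1.2 :=
    Primrec.snd.comp Primrec.fst
  have h : Primrec₂ fun (p : (Code × List Bool) × List Bool) (i : ℕ) => acceptsAt p.1.1 p.2 i :=
    (primrec_acceptsAt.comp (((Primrec.fst.comp (Primrec.fst.comp Primrec.fst)).pair
      (Primrec.snd.comp Primrec.fst)).pair Primrec.snd)).to₂
  exact (Primrec.eq.comp (primrec_initSeg h (Primrec.list_length.comp hτ)) hτ).decide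

theorem primrec_strings : Primrec strings := by
  have h : Primrec₂ fun (_ : ℕ) (p : ℕ × List (List Bool)) =>
      p.2.flatMap fun σ => [σ ++ [false], σ ++ [true]] := by
    have h1 (b : Bool) : Primrec fun q : (ℕ × ℕ × List (List Bool)) × List Bool => q.2 ++ [b] :=
      Primrec.list_append.comp Primrec.snd (Primrec.const [b])
    have h2 : Primrec₂ fun (_ : ℕ × ℕ × List (List Bool)) (σ : List Bool) =>
        [σ ++ [false], σ ++ [true]] :=
      (Primrec.list_cons.comp (h1 false) (Primrec.list_cons.comp (h1 true) (Primrec.const []))).to₂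
    have h3 : Primrec fun q : ℕ × ℕ × List (List Bool) => q.2.2 := Primrec.snd.comp Primrec.snd
    exact (Primrec.list_flatMap h3 h2).to₂
  refine (Primrec.nat_rec' Primrec.id (Primrec.const [[]]) h).of_eq fun n => ?_
  induction n with
  | zero => rfl
  | succ n ih => simp only [id] at ih ⊢; rw [ih]; rfl

theorem primrec_count : Primrec fun p : (Code × List Bool) × ℕ => count p.1.1 p.1.2 p.2 := by
  have h : PrimrecRel fun (σ : List Bool) (p : Code × List Bool) => matchesAt p.1 p.2 σ = true :=
    Primrec.eq.comp (primrec_matchesAt.comp (Primrec.snd.pair Primrec.fst)) (Primrec.const true)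
  exact Primrec.list_length.comp (h.listFilter.comp (primrec_strings.comp Primrec.snd) Primrec.fst)

theorem primrec_pow (k : ℕ) : Primrec fun n => k ^ n := by
  have h : Primrec₂ fun (_ : ℕ) (p : ℕ × ℕ) => p.2 * k :=
    (Primrec.nat_mul.comp (Primrec.snd.comp Primrec.snd) (Primrec.const k)).to₂
  refine (Primrec.nat_rec' Primrec.id (Primrec.const 1) h).of_eq fun n => ?_
  induction n with
  | zero => rfl
  | succ n ih => simp only [id] at ih ⊢; rw [ih, pow_succ]

theorem primrec_flag : Primrec fun p : (Code × List Bool) × ℕ => flag p.1.1 p.1.2 p.2 := by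
  let step (p : (Code × List Bool) × ℕ) (q : ℕ × Bool) : Bool :=
    if 3 ^ (p.1.2.length + 1) * 2 ^ q.1 <
      count p.1.1 (p.1.2 ++ [q.2]) q.1 * 4 ^ (p.1.2.length + 1) then !q.2 else q.2
  have h : Primrec₂ step := by
    have hτ : Primrec fun r : ((Code × List Bool) × ℕ) × ℕ × Bool => r.1.1.2 :=
      Primrec.snd.comp (Primrec.fst.comp Primrec.fst)
    have hc : Primrec fun r : ((Code × List Bool) × ℕ) × ℕ × Bool => r.1.1.1 :=
      Primrec.fst.comp (Primrec.fst.comp Primrec.fst)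
    have hs : Primrec fun r : ((Code × List Bool) × ℕ) × ℕ × Bool => r.2.1 :=
      Primrec.fst.comp Primrec.snd
    have hb : Primrec fun r : ((Code × List Bool) × ℕ) × ℕ × Bool => r.2.2 :=
      Primrec.snd.comp Primrec.snd
    have hl := Primrec.succ.comp (Primrec.list_length.comp hτ)
    exact (Primrec.ite (Primrec.nat_lt.comp
      (Primrec.nat_mul.comp ((primrec_pow 3).comp hl) ((primrec_pow 2).comp hs))
      (Primrec.nat_mul.comp (primrec_count.comp ((hc.pair (Primrec.list_concat.comp hτ hb)).pair hs))
        ((primrec_pow 4).comp hl))) (Primrec.not.comp hb) hb).to₂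
  refine (Primrec.nat_rec' Primrec.snd (Primrec.const false) h).of_eq fun p => ?_
  obtain ⟨p, n⟩ := p
  induction n with
  | zero => rfl
  | succ n ih => simp only [step] at ih ⊢; rw [ih]; rfl

theorem primrec_diagString :
    Primrec fun p : (Code × ℕ) × ℕ => diagString p.1.1 p.1.2 p.2 := by
  let step (p : (Code × ℕ) × ℕ) (q : ℕ × List Bool) : List Bool :=
    q.2 ++ [flag p.1.1 q.2 p.2]
  have h : Primrec₂ step := by
    have hl : Primrec fun r : ((Code × ℕ) × ℕ) × ℕ × List Bool => r.2.2 :=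
      Primrec.snd.comp Primrec.snd
    exact (Primrec.list_concat.comp hl (primrec_flag.comp (((Primrec.fst.comp
      (Primrec.fst.comp Primrec.fst)).pair hl).pair (Primrec.snd.comp Primrec.fst)))).to₂
  refine (Primrec.nat_rec' (Primrec.snd.comp Primrec.fst) (Primrec.const []) h).of_eq fun p => ?_
  obtain ⟨⟨c, n⟩, t⟩ := p
  induction n with
  | zero => rfl
  | succ n ih => simp only [step] at ih ⊢; rw [ih]; rfl

end Superhigh

namespace Superhigh

/-! ### Measures of clopen sets -/

theorem mem_strings {t : ℕ} {σ : List Bool} : σ ∈ strings t ↔ σ.length = t := by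
  induction t generalizing σ with
  | zero => simp [strings]
  | succ t ih =>
    simp only [strings, List.mem_flatMap, ih]
    constructor
    · rintro ⟨ρ, hρ, h⟩
      simp only [List.mem_cons, List.not_mem_nil, or_false] at h
      rcases h with rfl | rfl <;> simp [hρ]
    · intro h
      rcases List.eq_nil_or_concat σ with rfl | ⟨ρ, b, rfl⟩
      · simp at h
      · exact ⟨ρ, by simpa using h, by cases b <;> simp⟩

theorem nodup_strings (t : ℕ) : (strings t).Nodup := by
  induction t with
  | zero => simp [strings]
  | succ t ih =>
    rw [strings, List.nodup_flatMap]
    refine ⟨fun σ _ => by simp, ih.imp fun {σ ρ} h => ?_⟩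
    simp only [Function.onFun, List.disjoint_left]
    simp [h]

open MeasureTheory

instance : IsProbabilityMeasure coinMeasure := by
  unfold coinMeasure
  infer_instance

/-- Cylinders as finite boxes, the form to which the product measure formula applies. -/
theorem setOf_initSeg_eq (σ : List Bool) : {A : ℕ → Bool | initSeg A σ.length = σ} =
    Set.pi (Finset.range σ.length) fun i => {σ.getD i false} := by
  ext A
  have h : initSeg (fun i => σ.getD i false) σ.length = σ := by
    apply List.ext_getElem? fun i => ?_
    rw [getElem?_initSeg]
    split_ifs with hi <;> simp [hi]
  rw [Set.mem_ofPred_eq]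
  nth_rw 2 [← h]
  rw [initSeg_congr]
  simp [Set.mem_pi]

theorem measurableSet_initSeg_eq (σ : List Bool) :
    MeasurableSet {A : ℕ → Bool | initSeg A σ.length = σ} := by
  rw [setOf_initSeg_eq]
  exact MeasurableSet.pi (Finset.countable_toSet _) fun i _ => measurableSet_singleton _

theorem coinMeasure_initSeg_eq (σ : List Bool) :
    coinMeasure {A : ℕ → Bool | initSeg A σ.length = σ} = 2⁻¹ ^ σ.length := by
  rw [setOf_initSeg_eq, coinMeasure,
    Measure.infinitePi_pi _ fun i _ => measurableSet_singleton _]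
  simp

theorem setOf_initSeg_mem (p : List Bool → Bool) (t : ℕ) : {A : ℕ → Bool | p (initSeg A t) = true} =
    ⋃ σ ∈ ((strings t).filter fun σ => p σ = true).toFinset, {A | initSeg A σ.length = σ} := by
  ext A
  simp only [Set.mem_ofPred_eq, Set.mem_iUnion, List.mem_toFinset, List.mem_filter, mem_strings,
    decide_eq_true_eq, exists_prop]
  constructor
  · exact fun h => ⟨initSeg A t, ⟨length_initSeg A t, h⟩, by simp⟩
  · rintro ⟨σ, ⟨rfl, h⟩, hσ⟩
    rwa [hσ]

theorem measurableSet_initSeg_mem (p : List Bool → Bool) (t : ℕ) :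
    MeasurableSet {A : ℕ → Bool | p (initSeg A t) = true} := by
  rw [setOf_initSeg_mem]
  exact Finset.measurableSet_biUnion _ fun σ _ => measurableSet_initSeg_eq σ

theorem coinMeasure_real_initSeg_mem (p : List Bool → Bool) (t : ℕ) :
    coinMeasure.real {A : ℕ → Bool | p (initSeg A t) = true} =
      ((strings t).filter fun σ => p σ = true).length / 2 ^ t := by
  have hdisj : Set.PairwiseDisjoint
      (((strings t).filter fun σ => p σ = true).toFinset : Set (List Bool))
      fun σ => {A : ℕ → Bool | initSeg A σ.length = σ} := by
    intro σ hσ ρ hρ hne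
    simp only [List.coe_toFinset, Set.mem_ofPred_eq, List.mem_filter, mem_strings] at hσ hρ
    refine Set.disjoint_left.2 fun A h1 h2 => hne ?_
    simp only [Set.mem_ofPred_eq, hσ.1, hρ.1] at h1 h2
    exact h1.symm.trans h2
  rw [measureReal_def, setOf_initSeg_mem, measure_biUnion_finset hdisj
    fun σ _ => measurableSet_initSeg_eq σ]
  rw [Finset.sum_congr rfl (g := fun _ => (2⁻¹ : ENNReal) ^ t)]
  · rw [Finset.sum_const, List.toFinset_card_of_nodup ((nodup_strings t).filter _)]
    simp [div_eq_mul_inv]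
  · intro σ hσ
    simp only [List.mem_toFinset, List.mem_filter, mem_strings] at hσ
    rw [coinMeasure_initSeg_eq, hσ.1]

/-! ### The diagonal sequence -/

open Nat.Partrec (Code)
open Filter Topology

section Limits

variable {c : Code} {V : (ℕ → Bool) → ℕ → Bool}

/-- The oracles for which the values of the functional `V` begin with `τ`. -/
def agreeing (V : (ℕ → Bool) → ℕ → Bool) (τ : List Bool) : Set (ℕ → Bool) :=
  {A | initSeg (V A) τ.length = τ}

theorem eventually_matchesAt (hV : ∀ A n, ∀ᶠ t in atTop, acceptsAt c (initSeg A t) n = V A n)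
    (τ : List Bool) (A : ℕ → Bool) :
    ∀ᶠ t in atTop, matchesAt c τ (initSeg A t) = true ↔ A ∈ agreeing V τ := by
  have : ∀ i ∈ Set.Iio τ.length, ∀ᶠ t in atTop, acceptsAt c (initSeg A t) i = V A i :=
    fun i _ => hV A i
  filter_upwards [(Set.finite_Iio _).eventually_all.2 this] with t ht
  rw [matchesAt, decide_eq_true_eq, agreeing, Set.mem_ofPred_eq, initSeg_congr.2 ht]

/-- For each oracle the approximate membership eventually becomes correct, and on a finite measure
space pointwise convergence of indicators gives convergence of measures. -/
theorem tendsto_count (hV : ∀ A n, ∀ᶠ t in atTop, acceptsAt c (initSeg A t) n = V A n)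
    (τ : List Bool) :
    Tendsto (fun t => (count c τ t / 2 ^ t : ℝ)) atTop (𝓝 (coinMeasure.real (agreeing V τ))) := by
  have h := tendsto_measure_of_tendsto_indicator_of_isFiniteMeasure atTop coinMeasure
    (fun t => measurableSet_initSeg_mem (matchesAt c τ) t) (eventually_matchesAt hV τ)
  refine ((ENNReal.tendsto_toReal (measure_ne_top _ _)).comp h).congr fun t => ?_
  exact coinMeasure_real_initSeg_mem (matchesAt c τ) t

theorem measurableSet_agreeing (hV : ∀ A n, ∀ᶠ t in atTop, acceptsAt c (initSeg A t) n = V A n)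
    (τ : List Bool) : MeasurableSet (agreeing V τ) :=
  measurableSet_of_tendsto_indicator atTop
    (fun t => measurableSet_initSeg_mem (matchesAt c τ) t) (eventually_matchesAt hV τ)

theorem coinMeasure_agreeing_concat
    (hV : ∀ A n, ∀ᶠ t in atTop, acceptsAt c (initSeg A t) n = V A n) (τ : List Bool) (b : Bool) :
    coinMeasure.real (agreeing V (τ ++ [b])) + coinMeasure.real (agreeing V (τ ++ [!b])) =
      coinMeasure.real (agreeing V τ) := by
  have h (b : Bool) (A : ℕ → Bool) :
      A ∈ agreeing V (τ ++ [b]) ↔ A ∈ agreeing V τ ∧ V A τ.length = b := by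
    simp [agreeing, initSeg_succ]
  rw [← measureReal_union _ (measurableSet_agreeing hV _)]
  · congr 1
    ext A
    rw [Set.mem_union, h, h]
    cases b <;> cases V A τ.length <;> simp
  · refine Set.disjoint_left.2 fun A h1 h2 => ?_
    have := ((h _ A).1 h1).2.symm.trans ((h _ A).1 h2).2
    simp at this

theorem threshold_lt_iff (τ : List Bool) (l t : ℕ) :
    3 ^ l * 2 ^ t < count c τ t * 4 ^ l ↔ (3 / 4 : ℝ) ^ l < count c τ t / 2 ^ t := by
  rw [div_pow, div_lt_div_iff₀ (by positivity) (by positivity)]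
  exact_mod_cast Iff.rfl

/-- The approximation converges to a bit that cuts the bound on the measure by a factor `3 / 4`. -/
theorem exists_eventually_flag_eq
    (hV : ∀ A n, ∀ᶠ t in atTop, acceptsAt c (initSeg A t) n = V A n) {τ : List Bool}
    (hτ : coinMeasure.real (agreeing V τ) ≤ (3 / 4) ^ τ.length) :
    ∃ b, (∀ᶠ t in atTop, flag c τ t = b) ∧
      coinMeasure.real (agreeing V (τ ++ [b])) ≤ (3 / 4) ^ (τ.length + 1) := by
  -- Otherwise the two parts would total at least `3/2` times `(3/4)^|τ|`. The strict inequality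
  -- puts the approximations for `b` eventually below the threshold.
  obtain ⟨b, hb⟩ : ∃ b, coinMeasure.real (agreeing V (τ ++ [b])) < (3 / 4) ^ (τ.length + 1) := by
    by_contra! h
    have h1 := coinMeasure_agreeing_concat hV τ true
    have h2 := h true
    have h3 := h (!true)
    have h4 : (0 : ℝ) < (3 / 4) ^ τ.length := by positivity
    rw [pow_succ] at h2 h3
    linarith
  obtain ⟨N, hN⟩ := eventually_atTop.1 ((tendsto_count hV (τ ++ [b])).eventually_lt_const hb)
  have hstay : ∀ t ≥ N, flag c τ t = b → flag c τ (t + 1) = b := by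
    intro t ht h
    rw [flag, h, if_neg ((threshold_lt_iff _ _ _).not.2 (hN t ht).not_gt)]
  -- Once the flag reaches `b` after `N` it stays there. If it never does, it stays at `!b` without
  -- flipping, so the approximations for `!b` never exceed the threshold, nor does their limit.
  by_cases h : ∃ t ≥ N, flag c τ t = b
  · obtain ⟨t, ht, h⟩ := h
    refine ⟨b, ?_, hb.le⟩
    filter_upwards [eventually_ge_atTop t] with s hs
    induction s, hs using Nat.le_induction with
    | base => exact h
    | succ s hs ih => exact hstay s (ht.trans hs) ih
  · push Not at h
    have h' : ∀ t ≥ N, flag c τ t = !b := fun t ht => Bool.eq_not.2 (h t ht)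
    refine ⟨!b, eventually_atTop.2 ⟨N, h'⟩, le_of_tendsto (tendsto_count hV _) ?_⟩
    filter_upwards [eventually_ge_atTop N] with t ht
    by_contra! hlt
    refine h (t + 1) (by omega) ?_
    rw [flag, h' t ht, if_pos ((threshold_lt_iff _ _ _).2 hlt), Bool.not_not]

/-- The diagonal sequence is a limit of computable approximations, and the set of oracles whose
values agree with it has measure zero. -/
theorem exists_diagonal (hV : ∀ A n, ∀ᶠ t in atTop, acceptsAt c (initSeg A t) n = V A n) :
    ∃ D : ℕ → Bool, (∀ n, ∀ᶠ t in atTop, flag c (diagString c n t) t = D n) ∧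
      ∀ n, coinMeasure.real (agreeing V (initSeg D n)) ≤ (3 / 4) ^ n := by
  -- For `τ` violating the measure bound `b τ` is arbitrary; the strings `T n` all satisfy the
  -- bound.
  choose! b hb hb' using fun τ => exists_eventually_flag_eq hV (τ := τ)
  let T : ℕ → List Bool := fun n => Nat.rec [] (fun _ τ => τ ++ [b τ]) n
  have hT (n : ℕ) : initSeg (fun n => b (T n)) n = T n := by
    induction n with
    | zero => rfl
    | succ n ih => rw [initSeg_succ, ih]
  have hlen (n : ℕ) : (T n).length = n := by rw [← hT, length_initSeg]
  have hm (n : ℕ) : coinMeasure.real (agreeing V (T n)) ≤ (3 / 4) ^ n := by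
    induction n with
    | zero => simp
    | succ n ih => simpa [hlen] using hb' (T n) (by rwa [hlen])
  have hflag (n : ℕ) := hb (T n) (by rw [hlen]; exact hm n)
  have hdiag (n : ℕ) : ∀ᶠ t in atTop, diagString c n t = T n := by
    induction n with
    | zero => exact .of_forall fun _ => rfl
    | succ n ih =>
      filter_upwards [ih, hflag n] with t h1 h2
      rw [diagString, h1, h2]
  refine ⟨fun n => b (T n), fun n => ?_, fun n => by rw [hT]; exact hm n⟩
  filter_upwards [hdiag n, hflag n] with t h1 h2
  rw [h1, h2]

end Limits

/-- Where the program `c` computes a truth-table reduction, the approximations converge. -/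
theorem eventually_acceptsAt {c : Code} {n : ℕ} {q : List ℕ} {T : List (List Bool)}
    (hc : Encodable.encode (q, T) ∈ c.eval n) (A : ℕ → Bool) :
    ∀ᶠ t in atTop, acceptsAt c (initSeg A t) n = decide (q.map (jump A) ∈ T) := by
  obtain ⟨k, hk⟩ := Code.evaln_complete.1 hc
  have hq : ∀ e ∈ {e | e ∈ q}, ∀ᶠ t in atTop, haltsWithin (initSeg A t) e = jump A e :=
    fun e _ => eventually_haltsWithin A e
  filter_upwards [eventually_ge_atTop k, (List.finite_toSet q).eventually_all.2 hq] with t ht hqt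
  have hrow : row c n t = (q, T) := by
    rw [row, Option.mem_def.1 (Code.evaln_mono ht hk)]
    simp
  rw [acceptsAt, length_initSeg, hrow, List.map_congr_left hqt]

/-! ### The diagonalization -/

/-- The recursion theorem resolves the circularity between `c` and `h`. The flags are total
computable for every code, whether or not they converge, so the reduction to `∅''` is available
before `c` is known. -/
theorem exists_diagonal_code {query : ℕ → List ℕ} {table : ℕ → List (List Bool)}
    (hq : Computable query) (ht : Computable table) :
    ∃ (c : Code) (h : ℕ → ℕ),
      (∀ n, Encodable.encode (query (h n), table (h n)) ∈ c.eval n) ∧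
      ∀ n, jump (jump fun _ => false) (h n) = true ↔
        ∀ᶠ t in atTop, flag c (diagString c n t) t = true := by
  -- `m` codes a program together with a position; evaluating at `s + t` turns `∃ s, ∀ t` into "for
  -- all large stages".
  let R (m s t : ℕ) : Bool := flag (Denumerable.ofNat Code m.unpair.1)
    (diagString (Denumerable.ofNat Code m.unpair.1) m.unpair.2 (s + t)) (s + t)
  have hR : Primrec fun p : (ℕ × ℕ) × ℕ => R p.1.1 p.1.2 p.2 := by
    have hm : Primrec fun p : (ℕ × ℕ) × ℕ => p.1.1.unpair :=
      Primrec.unpair.comp (Primrec.fst.comp Primrec.fst)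
    have hc : Primrec fun p : (ℕ × ℕ) × ℕ => Denumerable.ofNat Code p.1.1.unpair.1 :=
      (Primrec.ofNat Code).comp (Primrec.fst.comp hm)
    have hst : Primrec fun p : (ℕ × ℕ) × ℕ => p.1.2 + p.2 :=
      Primrec.nat_add.comp (Primrec.snd.comp Primrec.fst) Primrec.snd
    exact primrec_flag.comp ((hc.pair (primrec_diagString.comp
      ((hc.pair (Primrec.snd.comp hm)).pair hst))).pair hst)
  obtain ⟨g, hg, hg'⟩ := exists_computable_jump_jump_iff hR.to_comp
  have hgc : Computable fun p : Code × ℕ => g (Nat.pair (Encodable.encode p.1) p.2) :=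
    hg.comp (Primrec₂.natPair.to_comp.comp (Computable.encode.comp Computable.fst) Computable.snd)
  have hf : Computable fun p : Code × ℕ => Encodable.encode
      (query (g (Nat.pair (Encodable.encode p.1) p.2)),
        table (g (Nat.pair (Encodable.encode p.1) p.2))) :=
    Computable.encode.comp ((hq.comp hgc).pair (ht.comp hgc))
  obtain ⟨c, hc⟩ := Code.fixed_point₂ (f := fun c n => Part.some (Encodable.encode
    (query (g (Nat.pair (Encodable.encode c) n)), table (g (Nat.pair (Encodable.encode c) n)))))
    hf.partrec
  refine ⟨c, fun n => g (Nat.pair (Encodable.encode c) n), fun n => ?_, fun n => ?_⟩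
  · rw [hc]
    exact Part.mem_some _
  · rw [hg', eventually_atTop]
    simp only [R, Nat.unpair_pair, Denumerable.ofNat_encode]
    refine exists_congr fun s => ⟨fun h t hst => ?_, fun h t => h _ (Nat.le_add_right s t)⟩
    simpa [Nat.add_sub_cancel' hst] using h (t - s)

theorem isPi02Class_frequently {p : ℕ → List Bool → Bool}
    (hp : Computable fun q : ℕ × List Bool => p q.1 q.2) :
    IsPi02Class {A | ∀ n, ∃ᶠ t in atTop, p n (initSeg A t) = true} := by
  -- The index `m` codes `(n, s)`: the `m`-th open set requires success for `n` at some stage at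
  -- least `s`.
  refine ⟨fun m σ => (decide (m.unpair.2 ≤ σ.length) && p m.unpair.1 σ) = true, ?_, ?_⟩
  · have hm : Primrec fun q : ℕ × List Bool => q.1.unpair := Primrec.unpair.comp Primrec.fst
    have h1 : Primrec fun q : ℕ × List Bool => decide (q.1.unpair.2 ≤ q.2.length) :=
      (Primrec.nat_le.comp (Primrec.snd.comp hm) (Primrec.list_length.comp Primrec.snd)).decide
    have h3 : Primrec fun q : ℕ × List Bool => (q.1.unpair.1, q.2) :=
      (Primrec.fst.comp hm).pair Primrec.snd
    have h4 := Computable.comp hp h3.to_comp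
    have h2 : Computable fun q : ℕ × List Bool =>
        decide (q.1.unpair.2 ≤ q.2.length) && p q.1.unpair.1 q.2 :=
      Computable₂.comp (f := fun a b : Bool => a && b) Primrec.and.to_comp h1.to_comp h4
    exact ComputablePred.to_re (ComputablePred.computable_iff.2 ⟨_, h2, rfl⟩)
  · ext A
    simp only [Set.mem_ofPred_eq, frequently_atTop, Bool.and_eq_true, decide_eq_true_eq,
      length_initSeg]
    constructor
    · exact fun h m => h _ _
    · intro h n s
      simpa using h (Nat.pair n s)

theorem not_isWeaklyTwoRandom_of_isSuperhigh {Z : ℕ → Bool} (hZ : IsSuperhigh Z) :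
    ¬ IsWeaklyTwoRandom Z := by
  obtain ⟨query, table, hq, ht, hred⟩ := hZ
  obtain ⟨c, h, hc, hjump⟩ := exists_diagonal_code hq ht
  let V (A : ℕ → Bool) (n : ℕ) : Bool := decide ((query (h n)).map (jump A) ∈ table (h n))
  have hV : ∀ A n, ∀ᶠ t in atTop, acceptsAt c (initSeg A t) n = V A n :=
    fun A n => eventually_acceptsAt (hc n) A
  obtain ⟨D, hD, hmeas⟩ := exists_diagonal hV
  let p (n : ℕ) (σ : List Bool) : Bool :=
    decide (acceptsAt c σ n = flag c (diagString c n σ.length) σ.length)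
  have hp : Primrec fun q : ℕ × List Bool => p q.1 q.2 := by
    have hl : Primrec fun q : ℕ × List Bool => q.2.length := Primrec.list_length.comp Primrec.snd
    exact (Primrec.eq.comp
      (primrec_acceptsAt.comp (((Primrec.const c).pair Primrec.snd).pair Primrec.fst))
      (primrec_flag.comp (((Primrec.const c).pair (primrec_diagString.comp
        (((Primrec.const c).pair Primrec.fst).pair hl))).pair hl))).decide
  have hpV (A : ℕ → Bool) (n : ℕ) :
      ∀ᶠ t in atTop, p n (initSeg A t) = true ↔ V A n = D n := by
    filter_upwards [hV A n, hD n] with t h1 h2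
    simp only [p, length_initSeg, decide_eq_true_eq, h1, h2]
  -- Agreement of the approximations eventually has a constant truth value, so "infinitely often"
  -- coincides with equality of the limits.
  have hS : {A | ∀ n, ∃ᶠ t in atTop, p n (initSeg A t) = true} = {A | ∀ n, V A n = D n} := by
    ext A
    refine forall_congr' fun n => ?_
    rw [frequently_congr (hpV A n), frequently_const]
  intro hrandom
  refine hrandom _ (isPi02Class_frequently hp.to_comp) ?_ ?_
  · rw [hS, ← measureReal_eq_zero_iff]
    refine le_antisymm (ge_of_tendsto'
      (tendsto_pow_atTop_nhds_zero_of_lt_one (r := (3 / 4 : ℝ)) (by norm_num) (by norm_num))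
      fun n => (measureReal_mono fun A hA => ?_).trans (hmeas n)) measureReal_nonneg
    rw [agreeing, Set.mem_ofPred_eq, length_initSeg, initSeg_congr]
    exact fun i _ => hA i
  · rw [hS]
    intro n
    -- Superhighness identifies `V Z n` with `∅''` at `h n`, and the choice of `h` identifies that
    -- with `D n`.
    have h1 : V Z n = true ↔ D n = true := by
      rw [decide_eq_true_eq, ← hred, hjump]
      rw [eventually_congr ((hD n).mono fun t h => by rw [h]), eventually_const]
    exact Bool.eq_iff_iff.2 h1

end Superhigh

theorem corollary3p3 :
    ¬ ∃ Z : ℕ → Bool, Superhigh.IsWeaklyTwoRandom Z ∧ Superhigh.IsSuperhigh Z :=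
  fun ⟨_, hrandom, hhigh⟩ => Superhigh.not_isWeaklyTwoRandom_of_isSuperhigh hhigh hrandom
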